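/- All systems are finite-dimensional. For systems $A$, $B$, $C$ with fixed orthonormal bases, $|C|\ge 1$ is the dimension of $C$, and a channel is a completely positive trace-preserving (CPTP) linear map between operator spaces. Let $\rho_{AB}$ be any density matrix on $A\otimes B$, with $A$ held by Alice and $B$ by Bob, and let $C_0$ be a system of the same dimension as $C$, identified with $C$. The entanglement fidelity of a map $\Lambda:C_0\to C$ is $F(\Lambda)=\langle\Phi^+|(\mathrm{id}\otimes\Lambda)(|\Phi^+\rangle\langle\Phi^+|)|\Phi^+\rangle$ with $|\Phi^+\rangle=|C|^{-1/2}\sum_{i}|i\rangle|i\rangle$. **One-way LOCC (Alice to Bob).** $\rho_{AB}$ generates $\Lambda:C_0\to C$ by one-way LOCC if there are a system $A'$, finitely many completely positive maps $\Phi_i:AC_0\to A'$ with $\sum_i\Phi_i$ trace preserving (a quantum instrument of Alice), and channels $\mathcal E_i:B\to C$ (applied by Bob on receiving the outcome $i$) such that for all $\tau$ $$\Lambda(\tau)=\mathrm{Tr}_{A'}\sum_i(\Phi_i\otimes\mathcal E_i)(\rho_{AB}\otimes\tau_{C_0}).$$ **Maximal port-based teleportation.** $\rho_{AB}$ generates $\Lambda:C_0\to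 C$ using $\mathsf{PBT}_{\max}$ if there are an integer $n$, a channel $\mathcal E:B\to C^{n}=C_1\otimes\cdots\otimes C_n$, where each port $C_i$ is a copy of $C$ (Bob's pre-processing), and a POVM $\{\Pi^{(i)}_{AC_0}\}_{i=1}^n$ on $A\otimes C_0$ (Alice's measurement) such that for all $\tau$ $$\Lambda(\tau)=\sum_{i=1}^n\mathrm{Tr}_{AC_0}\big[(\Pi^{(i)}_{AC_0}\otimes\mathbb 1_C)(\sigma^{(i)}_{AC}\otimes\tau_{C_0})\big],$$ where $\sigma_{AC^n}=(\mathrm{id}_A\otimes\mathcal E)(\rho_{AB})$, and $\sigma^{(i)}_{AC}$ is obtained from it by tracing out all ports except $C_i$ and relabelling $C_i$ as $C$. That is, on receiving $i$ Bob only discards all ports but the $i$-th. **Corollary.** The state $\rho_{AB}$ can generate by one-way LOCC some $\Lambda:C_0\to C$ with $F(\Lambda)>\frac1{|C|}$ if and only if it can generate some $\Lambda:C_0\to C$ with $F(\Lambda)>\frac1{|C|}$ using $\mathsf{PBT}_{\max}$. -/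

import Mathlib

/-!
Finite-dimensional quantum systems are represented by finite index types: a system `A` has
Hilbert space `ℂ^A` of dimension `|A| = Fintype.card A`, operators on it are matrices
`Matrix A A ℂ`, and the composite of `A` and `B` is indexed by `A × B`.
-/

namespace QuantumPBT

open scoped Kronecker ComplexOrder

/-- Density matrices: positive semidefinite with unit trace. -/
def IsDensity {A : Type*} [Fintype A] (ρ : Matrix A A ℂ) : Prop :=
  ρ.PosSemidef ∧ ρ.trace = 1

/-- Linear maps from operators on `A` to operators on `B`. -/
abbrev SuperOp (A B : Type*) : Type _ := Matrix A A ℂ →ₗ[ℂ] Matrix B B ℂ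

/-- The map `id_R ⊗ Φ`: apply `Φ` to each `B`-block of an operator on `R ⊗ B`. -/
def idTensor (R : Type*) {B C : Type*} (Φ : SuperOp B C) : SuperOp (R × B) (R × C) where
  toFun X := Matrix.of fun p q =>
    Φ (Matrix.of fun b b' => X (p.1, b) (q.1, b')) p.2 q.2
  map_add' X Y := by
    ext p q
    exact congrFun (congrFun (Φ.map_add
      (Matrix.of fun b b' => X (p.1, b) (q.1, b'))
      (Matrix.of fun b b' => Y (p.1, b) (q.1, b'))) p.2) q.2
  map_smul' c X := by
    ext p q
    exact congrFun (congrFun (Φ.map_smul c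
      (Matrix.of fun b b' => X (p.1, b) (q.1, b'))) p.2) q.2

/-- The map `Φ ⊗ id_R`: apply `Φ` to each `A`-block of an operator on `A ⊗ R`. -/
def tensorId (R : Type*) {A A' : Type*} (Φ : SuperOp A A') : SuperOp (A × R) (A' × R) where
  toFun X := Matrix.of fun p q =>
    Φ (Matrix.of fun a a' => X (a, p.2) (a', q.2)) p.1 q.1
  map_add' X Y := by
    ext p q
    exact congrFun (congrFun (Φ.map_add
      (Matrix.of fun a a' => X (a, p.2) (a', q.2))
      (Matrix.of fun a a' => Y (a, p.2) (a', q.2))) p.1) q.1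
  map_smul' c X := by
    ext p q
    exact congrFun (congrFun (Φ.map_smul c
      (Matrix.of fun a a' => X (a, p.2) (a', q.2))) p.1) q.1

/-- The tensor product `Φ ⊗ Ψ = (Φ ⊗ id) ∘ (id ⊗ Ψ)`. -/
def tensorMap {A A' B B' : Type*} (Φ : SuperOp A A') (Ψ : SuperOp B B') :
    SuperOp (A × B) (A' × B') :=
  tensorId B' Φ ∘ₗ idTensor A Ψ

/-- Complete positivity: `id_k ⊗ Φ` preserves positive semidefiniteness for every `k`. -/
def IsCP {A B : Type*} (Φ : SuperOp A B) : Prop :=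
  ∀ (k : ℕ) (X : Matrix (Fin k × A) (Fin k × A) ℂ),
    X.PosSemidef → (idTensor (Fin k) Φ X).PosSemidef

/-- Trace preservation. -/
def IsTP {A B : Type*} [Fintype A] [Fintype B] (Φ : SuperOp A B) : Prop :=
  ∀ X : Matrix A A ℂ, (Φ X).trace = X.trace

/-- Quantum channels (CPTP maps). -/
def IsChannel {A B : Type*} [Fintype A] [Fintype B] (Φ : SuperOp A B) : Prop :=
  IsCP Φ ∧ IsTP Φ

/-- Partial trace over the first tensor factor. -/
def traceFst {A B : Type*} [Fintype A] (X : Matrix (A × B) (A × B) ℂ) : Matrix B B ℂ :=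
  Matrix.of fun b b' => ∑ a, X (a, b) (a, b')

/-- The operator `ρ_{AB} ⊗ τ_{C₀}`, with the tensor factors ordered as `(A ⊗ C₀) ⊗ B`
(Alice holds `A` and the channel input `C₀`, Bob holds `B`). -/
def withInput {A B C₀ : Type*} (ρ : Matrix (A × B) (A × B) ℂ) (τ : Matrix C₀ C₀ ℂ) :
    Matrix ((A × C₀) × B) ((A × C₀) × B) ℂ :=
  Matrix.of fun p q => ρ (p.1.1, p.2) (q.1.1, q.2) * τ p.1.2 q.1.2

/-- One-way LOCC maps from Alice to Bob: Alice applies a quantum instrument `(Φ i)`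
(CP maps that sum to a trace-preserving map), sends the outcome `i` to Bob, and Bob applies
a channel `E i` depending on it. -/
def IsOneWayLOCC {A A' B B' : Type*} [Fintype A] [Fintype A'] [Fintype B] [Fintype B']
    (L : SuperOp (A × B) (A' × B')) : Prop :=
  ∃ (m : ℕ) (Φ : Fin m → SuperOp A A') (E : Fin m → SuperOp B B'),
    (∀ i, IsCP (Φ i)) ∧ IsTP (∑ i, Φ i) ∧ (∀ i, IsChannel (E i)) ∧
      L = ∑ i, tensorMap (Φ i) (E i)

/-- The channels `C₀ → C` generated from the shared state `ρ` by one-way LOCC from Alice to Bob: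
the input is adjoined to Alice's side, a one-way LOCC map with output `C` for Bob is applied, and
the system that Alice is left with (of arbitrary dimension `k`) is discarded. -/
def oneWayLOCC {A B : Type*} [Fintype A] [Fintype B] (ρ : Matrix (A × B) (A × B) ℂ)
    (C₀ C : Type*) [Fintype C₀] [Fintype C] : Set (SuperOp C₀ C) :=
  {Λ | ∃ (k : ℕ) (L : SuperOp ((A × C₀) × B) (Fin k × C)),
    IsOneWayLOCC L ∧ ∀ τ, Λ τ = traceFst (L (withInput ρ τ))}

/-- POVMs with `n` outcomes. -/
def IsPOVM {A : Type*} [DecidableEq A] {n : ℕ} (P : Fin n → Matrix A A ℂ) : Prop :=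
  (∀ i, (P i).PosSemidef) ∧ ∑ i, P i = 1

/-- Partial trace over all ports `C_j`, `j ≠ i`, of `Cⁿ = C₁ ⊗ ⋯ ⊗ C_n` (basis indexed by
`Fin n → C`), with port `i` relabelled to `C`. The row index runs over all `f` with `f i = c`;
the column index agrees with `f` at every `j ≠ i` and is `c'` at `i`. -/
def keepPort {C : Type*} [Fintype C] [DecidableEq C] {n : ℕ} (i : Fin n) :
    SuperOp (Fin n → C) C where
  toFun X := Matrix.of fun c c' =>
    ∑ f : Fin n → C, if f i = c then X f (Function.update f i c') else 0
  map_add' X Y := by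
    ext c c'
    simp only [Matrix.of_apply, Matrix.add_apply, ← Finset.sum_add_distrib]
    exact Finset.sum_congr rfl fun f _ => by split_ifs <;> simp
  map_smul' z X := by
    ext c c'
    simp only [Matrix.of_apply, Matrix.smul_apply, RingHom.id_apply, smul_eq_mul,
      Finset.mul_sum]
    exact Finset.sum_congr rfl fun f _ => by split_ifs <;> simp

/-- Standard port-based teleportation with a shared state `σ` on `A ⊗ Cⁿ`: the channels
`Λ(τ) = ∑ i, Tr_{A C₀} [(Π_i ⊗ 1_C) (σ⁽ⁱ⁾ ⊗ τ)]`, where `Π` is a POVM on `A ⊗ C₀` and `σ⁽ⁱ⁾` is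
the marginal of `σ` on `A` and port `i`. -/
def PBT {A : Type*} [Fintype A] [DecidableEq A] {C : Type*} [Fintype C] [DecidableEq C] {n : ℕ}
    (σ : Matrix (A × (Fin n → C)) (A × (Fin n → C)) ℂ)
    (C₀ : Type*) [Fintype C₀] [DecidableEq C₀] : Set (SuperOp C₀ C) :=
  {Λ | ∃ P : Fin n → Matrix (A × C₀) (A × C₀) ℂ, IsPOVM P ∧
    ∀ τ, Λ τ = ∑ i, traceFst
      ((P i ⊗ₖ (1 : Matrix C C ℂ)) * withInput (idTensor A (keepPort i) σ) τ)}

/-- Maximal port-based teleportation: Bob first applies a channel `E : B → Cⁿ`, for any number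
`n` of ports, and the resulting state is used for standard port-based teleportation. -/
def PBTmax {A B : Type*} [Fintype A] [DecidableEq A] [Fintype B]
    (ρ : Matrix (A × B) (A × B) ℂ)
    (C₀ C : Type*) [Fintype C₀] [DecidableEq C₀] [Fintype C] [DecidableEq C] :
    Set (SuperOp C₀ C) :=
  {Λ | ∃ (n : ℕ) (E : SuperOp B (Fin n → C)),
    IsChannel E ∧ Λ ∈ PBT (idTensor A E ρ) C₀}

/-- The maximally entangled unit vector `|C|^{-1/2} ∑ i, |i⟩|i⟩`. -/
noncomputable def maxEntVec (C : Type*) [Fintype C] [DecidableEq C] : C × C → ℂ :=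
  fun p => if p.1 = p.2 then ((1 / Real.sqrt (Fintype.card C) : ℝ) : ℂ) else 0

/-- Entanglement fidelity `⟨Φ⁺| (id ⊗ Λ)(|Φ⁺⟩⟨Φ⁺|) |Φ⁺⟩`. The number is real for every
completely positive `Λ`, so only the zero imaginary part is dropped. -/
noncomputable def entFidelity {C : Type*} [Fintype C] [DecidableEq C] (Λ : SuperOp C C) : ℝ :=
  (star (maxEntVec C) ⬝ᵥ
    (idTensor C Λ (Matrix.vecMulVec (maxEntVec C) (star (maxEntVec C)))).mulVec
      (maxEntVec C)).re

end QuantumPBT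

namespace QuantumPBT

open scoped Kronecker ComplexOrder

/-! Write d = |C|. A protocol with effects P_i and shared states σ_i on A ⊗ C has F = d⁻² ∑ Tr(P_i
σ_i), so F > 1/d means ∑ Tr(P_i σ_i) > d (`one_div_card_lt_entFidelity_iff`). PBT is a special case
of LOCC, since discarding ports is a channel. Conversely, ρ_A ⊗ 1 has trace d and the P_i sum to 1,
so a good LOCC protocol has an outcome i with Tr(P_i σ_i) > Tr(P_i (ρ_A ⊗ 1)). Bob puts E_i(B) in
port 0 and the d basis states in the other ports, whose marginals T_j = ρ_A ⊗ |j⟩⟨j| sum to ρ_A ⊗ 1.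
Measuring C₀ in the basis already scores exactly d; diverting a small weight along P_i to port 0
gains to first order (`exists_povm_sum_trace_lt`). -/

theorem idTensor_comp (R : Type*) {A B C : Type*} (Φ : SuperOp A B) (Ψ : SuperOp B C)
    (X : Matrix (R × A) (R × A) ℂ) :
    idTensor R (Ψ ∘ₗ Φ) X = idTensor R Ψ (idTensor R Φ X) := rfl

theorem idTensor_sum (R : Type*) {ι A B : Type*} (s : Finset ι) (Φ : ι → SuperOp A B)
    (X : Matrix (R × A) (R × A) ℂ) :
    idTensor R (∑ i ∈ s, Φ i) X = ∑ i ∈ s, idTensor R (Φ i) X := by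
  ext p q
  simp [idTensor, Matrix.sum_apply, LinearMap.sum_apply]

theorem IsCP.comp {A B C : Type*} {Φ : SuperOp A B} {Ψ : SuperOp B C}
    (hΨ : IsCP Ψ) (hΦ : IsCP Φ) : IsCP (Ψ ∘ₗ Φ) :=
  fun k X hX => hΨ k _ (hΦ k X hX)

theorem IsCP.sum {ι A B : Type*} (s : Finset ι) {Φ : ι → SuperOp A B}
    (h : ∀ i ∈ s, IsCP (Φ i)) : IsCP (∑ i ∈ s, Φ i) := by
  intro k X hX
  rw [idTensor_sum]
  exact Matrix.posSemidef_sum s fun i hi => h i hi k X hX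

theorem IsChannel.comp {A B C : Type*} [Fintype A] [Fintype B] [Fintype C]
    {Φ : SuperOp A B} {Ψ : SuperOp B C} (hΨ : IsChannel Ψ) (hΦ : IsChannel Φ) :
    IsChannel (Ψ ∘ₗ Φ) :=
  ⟨hΨ.1.comp hΦ.1, fun X => (hΨ.2 _).trans (hΦ.2 X)⟩

/-- A completely positive map preserves positivity next to any finite reference system. -/
theorem IsCP.posSemidef_idTensor {R A B : Type*} [Fintype R] {Φ : SuperOp A B} (hΦ : IsCP Φ)
    {X : Matrix (R × A) (R × A) ℂ} (hX : X.PosSemidef) : (idTensor R Φ X).PosSemidef := by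
  let e := Fintype.equivFin R
  have h := hΦ (Fintype.card R) _ (hX.submatrix (Prod.map e.symm id))
  convert h.submatrix (Prod.map e id) using 1
  ext p q
  simp [idTensor]

theorem IsCP.posSemidef {A B : Type*} {Φ : SuperOp A B} (hΦ : IsCP Φ)
    {X : Matrix A A ℂ} (hX : X.PosSemidef) : (Φ X).PosSemidef :=
  (hΦ 1 _ (hX.submatrix Prod.snd)).submatrix fun b => (0, b)

/-- Conjugation `X ↦ K X Kᴴ` by a Kraus operator `K`. -/
def krausMap {A B : Type*} [Fintype A] (K : Matrix B A ℂ) : SuperOp A B where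
  toFun X := K * X * K.conjTranspose
  map_add' X Y := by rw [Matrix.mul_add, Matrix.add_mul]
  map_smul' c X := by simp

theorem krausMap_apply_apply {A B : Type*} [Fintype A] (K : Matrix B A ℂ) (X : Matrix A A ℂ)
    (b b' : B) : krausMap K X b b' = ∑ a', ∑ a, K b a * X a a' * star (K b' a') := by
  simp [krausMap, Matrix.mul_apply, Finset.sum_mul]

theorem isCP_krausMap {A B : Type*} [Fintype A] [Fintype B] (K : Matrix B A ℂ) : IsCP (krausMap K) := by
  intro k X hX
  convert hX.mul_mul_conjTranspose_same ((1 : Matrix (Fin k) (Fin k) ℂ) ⊗ₖ K) using 1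
  ext p q
  simp only [idTensor, LinearMap.coe_mk, AddHom.coe_mk, krausMap_apply_apply, Matrix.mul_apply,
    Matrix.of_apply, Finset.sum_mul, Fintype.sum_prod_type, Matrix.kroneckerMap_apply,
    Matrix.conjTranspose_apply, Matrix.one_apply]
  simp [apply_ite, ite_mul]

/-! ### Effects and positive functionals -/

/-- The completely positive functional `X ↦ Tr (P X)`, valued in a trivial system. -/
def traceAgainst {A : Type*} [Fintype A] (P : Matrix A A ℂ) : SuperOp A (Fin 1) where
  toFun X := Matrix.of fun _ _ => (P * X).trace
  map_add' X Y := by ext; simp [Matrix.mul_add]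
  map_smul' c X := by ext; simp

theorem trace_traceAgainst {A : Type*} [Fintype A] (P X : Matrix A A ℂ) :
    (traceAgainst P X).trace = (P * X).trace := by
  simp [traceAgainst, Matrix.trace]

/-- Decomposing P into terms v v* gives Kraus operators, the row vectors v*. -/
theorem isCP_traceAgainst {A : Type*} [Fintype A] {P : Matrix A A ℂ}
    (hP : P.PosSemidef) : IsCP (traceAgainst P) := by
  obtain ⟨m, v, rfl⟩ := Matrix.posSemidef_iff_eq_sum_vecMulVec.1 hP
  have : traceAgainst (∑ i, Matrix.vecMulVec (v i) (star (v i))) =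
      ∑ i, krausMap (Matrix.of fun (_ : Fin 1) a => star (v i a)) := by
    ext X b b'
    simp only [LinearMap.sum_apply, Matrix.sum_apply, krausMap_apply_apply]
    simp only [traceAgainst, LinearMap.coe_mk, AddHom.coe_mk, Matrix.of_apply, Matrix.sum_mul,
      Matrix.trace_sum, Matrix.vecMulVec_mul, Matrix.trace_vecMulVec, star_star]
    refine Finset.sum_congr rfl fun i _ => ?_
    simp [dotProduct, Matrix.vecMul, Finset.mul_sum, mul_comm]
  rw [this]
  exact IsCP.sum _ fun i _ => isCP_krausMap _

/-- A positive map followed by the trace is measurement of a positive operator. -/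
theorem IsCP.exists_posSemidef_trace_mul {A B : Type*} [Fintype A] [DecidableEq A] [Fintype B]
    {Φ : SuperOp A B} (hΦ : IsCP Φ) :
    ∃ P : Matrix A A ℂ, P.PosSemidef ∧ ∀ X, (Φ X).trace = (P * X).trace := by
  let P : Matrix A A ℂ := Matrix.of fun a b => (Φ (Matrix.single b a 1)).trace
  have key : ∀ X, (Φ X).trace = (P * X).trace := by
    intro X
    conv_lhs => rw [Matrix.matrix_eq_sum_single X]
    simp only [map_sum, Matrix.trace_sum]
    rw [Finset.sum_comm, Matrix.trace]
    refine Finset.sum_congr rfl fun a _ => ?_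
    rw [Matrix.diag_apply, Matrix.mul_apply]
    refine Finset.sum_congr rfl fun b _ => ?_
    have : Matrix.single b a (X b a) = X b a • Matrix.single b a (1 : ℂ) := by simp
    rw [this, map_smul, Matrix.trace_smul, smul_eq_mul, mul_comm]
    rfl
  have hq : ∀ x, 0 ≤ star x ⬝ᵥ (P.mulVec x) := by
    intro x
    have h := (hΦ.posSemidef (Matrix.posSemidef_vecMulVec_self_star x)).trace_nonneg
    rw [key] at h
    convert h using 1
    simp [Matrix.mul_vecMulVec, Matrix.trace_vecMulVec, dotProduct_comm]
  -- Over ℂ a nonnegative quadratic form already forces P to be Hermitian.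
  refine ⟨P, ?_, key⟩
  rw [← Matrix.isPositive_toEuclideanLin_iff, LinearMap.isPositive_iff_complex]
  intro x
  have h := hq x.ofLp
  have hx : inner ℂ (P.toEuclideanLin x) x = star (star x.ofLp ⬝ᵥ P.mulVec x.ofLp) := by
    rw [EuclideanSpace.inner_eq_star_dotProduct, Matrix.star_dotProduct, dotProduct_comm]
    simp
  rw [hx, h.isSelfAdjoint.star_eq]
  have h' := Complex.nonneg_iff.1 h
  exact ⟨Complex.ext rfl h'.2, h'.1⟩

theorem trace_mul_re_nonneg {A : Type*} [Fintype A] {P Q : Matrix A A ℂ}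
    (hP : P.PosSemidef) (hQ : Q.PosSemidef) : 0 ≤ (P * Q).trace.re := by
  have h := ((isCP_traceAgainst hP).posSemidef hQ).trace_nonneg
  rw [trace_traceAgainst] at h
  exact (Complex.nonneg_iff.1 h).1

/-! ### Protocol outputs in terms of effects -/

theorem traceFst_kronecker_mul_withInput {A B C : Type*} [Fintype A] [Fintype B] [Fintype C]
    [DecidableEq B] (P : Matrix (A × C) (A × C) ℂ) (σ : Matrix (A × B) (A × B) ℂ)
    (τ : Matrix C C ℂ) (b b' : B) :
    traceFst ((P ⊗ₖ (1 : Matrix B B ℂ)) * withInput σ τ) b b' =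
      ∑ p, ∑ q, P p q * (σ (q.1, b) (p.1, b') * τ q.2 p.2) := by
  simp only [traceFst, Matrix.of_apply, Matrix.mul_apply, withInput, Fintype.sum_prod_type _,
    Matrix.kroneckerMap_apply, Matrix.one_apply]
  simp

/-- Once Alice's output is discarded, her map matters only through its effect P. -/
theorem traceFst_tensorMap {A A' B C : Type*} [Fintype A] [Fintype A'] [Fintype C]
    [DecidableEq C]
    {Φ : SuperOp A A'} {P : Matrix A A ℂ} (hP : ∀ X, (Φ X).trace = (P * X).trace)
    (E : SuperOp B C) (X : Matrix (A × B) (A × B) ℂ) :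
    traceFst (tensorMap Φ E X) = traceFst ((P ⊗ₖ (1 : Matrix C C ℂ)) * idTensor A E X) := by
  ext c c'
  have h := hP (Matrix.of fun a a' => idTensor A E X (a, c) (a', c'))
  simp only [Matrix.trace, Matrix.diag_apply, Matrix.mul_apply, Matrix.of_apply] at h
  simp only [traceFst, Matrix.of_apply, Matrix.mul_apply, Fintype.sum_prod_type _,
    Matrix.kroneckerMap_apply, Matrix.one_apply]
  simpa [tensorMap, tensorId] using h

theorem idTensor_withInput {A B B' C : Type*} (E : SuperOp B B')
    (ρ : Matrix (A × B) (A × B) ℂ) (τ : Matrix C C ℂ) :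
    idTensor (A × C) E (withInput ρ τ) = withInput (idTensor A E ρ) τ := by
  ext ⟨⟨a, c⟩, b⟩ ⟨⟨a', c'⟩, b'⟩
  have : (Matrix.of fun b b' => ρ (a, b) (a', b') * τ c c') =
      τ c c' • (Matrix.of fun b b' => ρ (a, b) (a', b')) := by
    ext; simp [mul_comm]
  simp only [idTensor, withInput, LinearMap.coe_mk, AddHom.coe_mk, Matrix.of_apply, this, map_smul]
  exact mul_comm _ _

/-- The output of measuring `P` on `A ⊗ C₀` and applying `E i` to `B` on outcome `i`. -/
theorem traceFst_sum_tensorMap {ι A A' B C C₀ : Type*} [Fintype ι] [Fintype A] [Fintype A']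
    [Fintype C] [DecidableEq C] [Fintype C₀] {Φ : ι → SuperOp (A × C₀) A'}
    {P : ι → Matrix (A × C₀) (A × C₀) ℂ} (hP : ∀ i X, (Φ i X).trace = (P i * X).trace)
    (E : ι → SuperOp B C) (ρ : Matrix (A × B) (A × B) ℂ) (τ : Matrix C₀ C₀ ℂ) :
    traceFst ((∑ i, tensorMap (Φ i) (E i)) (withInput ρ τ)) =
      ∑ i, traceFst ((P i ⊗ₖ (1 : Matrix C C ℂ)) * withInput (idTensor A (E i) ρ) τ) := by
  have : ∀ Y : ι → Matrix (A' × C) (A' × C) ℂ, traceFst (∑ i, Y i) = ∑ i, traceFst (Y i) := by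
    intro Y
    ext c c'
    simp only [traceFst, Matrix.of_apply, Matrix.sum_apply]
    exact Finset.sum_comm
  rw [LinearMap.sum_apply, this]
  refine Finset.sum_congr rfl fun i _ => ?_
  rw [traceFst_tensorMap (hP i), idTensor_withInput]

/-! ### Entanglement fidelity as a sum of traces -/

theorem entFidelity_eq {C : Type*} [Fintype C] [DecidableEq C] (Λ : SuperOp C C) :
    entFidelity Λ =
      1 / (Fintype.card C : ℝ) ^ 2 * (∑ j, ∑ k, Λ (Matrix.single j k 1) j k).re := by
  set s : ℂ := ((1 / Real.sqrt (Fintype.card C) : ℝ) : ℂ) with hs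
  have hss : s * s = ((1 / (Fintype.card C : ℝ) : ℝ) : ℂ) := by
    rw [hs, ← Complex.ofReal_mul, div_mul_div_comm, Real.mul_self_sqrt (Nat.cast_nonneg _), one_mul]
  have hst : star s = s := by simp [hs]
  have hv : ∀ j k, (Matrix.of fun b b' => maxEntVec C (j, b) * maxEntVec C (k, b')) =
      (s * s) • Matrix.single j k (1 : ℂ) := by
    intro j k
    ext b b'
    simp only [maxEntVec, ← hs, Matrix.of_apply, Matrix.smul_apply, Matrix.single_apply]
    split_ifs <;> simp_all
  have hvs : ∀ p, star (maxEntVec C p) = maxEntVec C p := by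
    intro p
    simp only [maxEntVec, ← hs]
    split_ifs <;> simp [hst]
  have : star (maxEntVec C) ⬝ᵥ
      (idTensor C Λ (Matrix.vecMulVec (maxEntVec C) (star (maxEntVec C)))).mulVec
        (maxEntVec C) = (s * s * (s * s)) * ∑ j, ∑ k, Λ (Matrix.single j k 1) j k := by
    simp only [dotProduct, Matrix.mulVec, idTensor, LinearMap.coe_mk, AddHom.coe_mk,
      Matrix.of_apply, Matrix.vecMulVec_apply, Pi.star_apply, hvs, Fintype.sum_prod_type]
    simp only [hv, map_smul, Matrix.smul_apply, smul_eq_mul]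
    simp only [maxEntVec, ← hs]
    simp only [ite_mul, mul_ite, zero_mul, mul_zero, Finset.sum_ite_irrel,
      Finset.sum_const_zero, Finset.sum_ite_eq, Finset.mem_univ, if_true,
      Finset.mul_sum]
    exact Finset.sum_congr rfl fun j _ => Finset.sum_congr rfl fun k _ => by ring
  rw [entFidelity, this, hss, ← Complex.ofReal_mul, Complex.re_ofReal_mul]
  congr 1
  ring

/-- Feeding in |j⟩⟨k| and reading off entry (j, k) identifies the input system of P_i with the
output system of σ_i, which closes the contraction into Tr(P_i σ_i). -/
theorem entFidelity_eq_sum_trace {ι A C : Type*} [Fintype ι] [Fintype A] [Fintype C]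
    [DecidableEq C] {Λ : SuperOp C C} {P σ : ι → Matrix (A × C) (A × C) ℂ}
    (hΛ : ∀ τ, Λ τ = ∑ i, traceFst ((P i ⊗ₖ (1 : Matrix C C ℂ)) * withInput (σ i) τ)) :
    entFidelity Λ = 1 / (Fintype.card C : ℝ) ^ 2 * ∑ i, (P i * σ i).trace.re := by
  rw [entFidelity_eq, ← Complex.re_sum]
  congr 2
  simp only [hΛ, Matrix.sum_apply, traceFst_kronecker_mul_withInput]
  simp only [Finset.sum_comm (s := Finset.univ (α := C)) (t := Finset.univ (α := ι))]
  refine Finset.sum_congr rfl fun i _ => ?_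
  have comm : ∀ f : C → C → A × C → A × C → ℂ,
      ∑ j, ∑ k, ∑ p, ∑ q, f j k p q = ∑ p, ∑ q, ∑ j, ∑ k, f j k p q := by
    intro f
    calc _ = ∑ x : C × C, ∑ y : (A × C) × (A × C), f x.1 x.2 y.1 y.2 := by
          simp only [Fintype.sum_prod_type]
      _ = ∑ y : (A × C) × (A × C), ∑ x : C × C, f x.1 x.2 y.1 y.2 := Finset.sum_comm
      _ = _ := by simp only [Fintype.sum_prod_type]
  rw [comm]
  simp [Matrix.trace, Matrix.mul_apply, Matrix.single_apply, ite_and]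

theorem one_div_card_lt_entFidelity_iff {ι A C : Type*} [Fintype ι] [Fintype A] [Fintype C]
    [DecidableEq C] [Nonempty C] {Λ : SuperOp C C} {P σ : ι → Matrix (A × C) (A × C) ℂ}
    (hΛ : ∀ τ, Λ τ = ∑ i, traceFst ((P i ⊗ₖ (1 : Matrix C C ℂ)) * withInput (σ i) τ)) :
    1 / (Fintype.card C : ℝ) < entFidelity Λ ↔
      (Fintype.card C : ℝ) < ∑ i, (P i * σ i).trace.re := by
  have hd : (0 : ℝ) < Fintype.card C := Nat.cast_pos.2 Fintype.card_pos
  rw [entFidelity_eq_sum_trace hΛ, one_div_mul_eq_div, div_lt_div_iff₀ hd (pow_pos hd 2), sq]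
  constructor <;> intro h <;> nlinarith

/-! ### Discarding and attaching ports -/

section Ports

variable {C : Type*} [Fintype C] [DecidableEq C] {n : ℕ}

/-- Makes complete positivity visible. Fixing the placeholder c₀ at port i counts each configuration
of the other ports once. -/
theorem keepPort_eq_sum_submatrix (i : Fin n) (c₀ : C)
    (X : Matrix (Fin n → C) (Fin n → C) ℂ) :
    keepPort i X = ∑ g : Fin n → C with g i = c₀,
      X.submatrix (Function.update g i) (Function.update g i) := by
  ext c c'
  simp only [keepPort, LinearMap.coe_mk, AddHom.coe_mk, Matrix.of_apply, Matrix.sum_apply,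
    Matrix.submatrix_apply]
  rw [← Finset.sum_filter]
  refine Finset.sum_nbij' (fun f => Function.update f i c₀) (fun g => Function.update g i c)
    ?_ ?_ ?_ ?_ ?_
  · simp
  · simp
  · intro f hf
    simp [← (Finset.mem_filter.1 hf).2]
  · intro f hf
    simp [← (Finset.mem_filter.1 hf).2]
  · intro f hf
    simp [← (Finset.mem_filter.1 hf).2]

theorem isChannel_keepPort [Nonempty C] (i : Fin n) : IsChannel (keepPort (C := C) i) := by
  constructor
  · intro k X hX
    obtain ⟨c₀⟩ := ‹Nonempty C›
    have : idTensor (Fin k) (keepPort i) X = ∑ g : Fin n → C with g i = c₀,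
        X.submatrix (Prod.map id (Function.update g i)) (Prod.map id (Function.update g i)) := by
      ext p q
      simp only [idTensor, LinearMap.coe_mk, AddHom.coe_mk, Matrix.of_apply,
        keepPort_eq_sum_submatrix i c₀, Matrix.sum_apply]
      rfl
    rw [this]
    exact Matrix.posSemidef_sum _ fun g _ => hX.submatrix _
  · intro X
    simp only [Matrix.trace, Matrix.diag_apply, keepPort, LinearMap.coe_mk, AddHom.coe_mk,
      Matrix.of_apply]
    rw [Finset.sum_comm]
    simp

/-- The isometry `|c⟩ ↦ |c⟩|e 0⟩⋯|e (n-1)⟩`. -/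
def attachIsometry (e : Fin n → C) : Matrix (Fin (n + 1) → C) C ℂ :=
  Matrix.of fun f c => if f = Fin.cons c e then 1 else 0

/-- The channel that keeps its input in port `0` and prepares the pure basis state `e j` in
port `j + 1`. -/
def attachPorts (e : Fin n → C) : SuperOp C (Fin (n + 1) → C) :=
  krausMap (attachIsometry e)

theorem isChannel_attachPorts (e : Fin n → C) : IsChannel (attachPorts e) := by
  refine ⟨isCP_krausMap _, fun X => ?_⟩
  have h : (attachIsometry e).conjTranspose * attachIsometry e = 1 := by
    ext c c'
    simp [attachIsometry, Matrix.mul_apply, Matrix.one_apply, apply_ite, Fin.cons_inj, eq_comm]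
  simp only [attachPorts, krausMap, LinearMap.coe_mk, AddHom.coe_mk]
  rw [Matrix.trace_mul_comm, ← Matrix.mul_assoc, h, Matrix.one_mul]

theorem attachPorts_apply_apply (e : Fin n → C) (X : Matrix C C ℂ) (f g : Fin (n + 1) → C) :
    attachPorts e X f g = if Fin.tail f = e ∧ Fin.tail g = e then X (f 0) (g 0) else 0 := by
  have h : ∀ (f : Fin (n + 1) → C) c,
      attachIsometry e f c = if c = f 0 then if Fin.tail f = e then 1 else 0 else 0 := by
    intro f c
    induction f using Fin.consCases with
    | _ x y => simp only [attachIsometry, Matrix.of_apply, Fin.cons_inj, Fin.cons_zero,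
        Fin.tail_cons, ite_and, eq_comm]
  rw [attachPorts, krausMap_apply_apply]
  simp only [h]
  simp only [ite_mul, zero_mul, apply_ite star, star_zero, mul_ite, mul_zero]
  by_cases h1 : Fin.tail f = e <;> by_cases h2 : Fin.tail g = e <;> simp [h1, h2]

theorem keepPort_zero_attachPorts (e : Fin n → C) (X : Matrix C C ℂ) :
    keepPort 0 (attachPorts e X) = X := by
  ext c c'
  simp only [keepPort, LinearMap.coe_mk, AddHom.coe_mk, Matrix.of_apply, attachPorts_apply_apply]
  rw [← (Fin.consEquiv fun _ => C).sum_comp]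
  simp [Fin.consEquiv, Fintype.sum_prod_type]

theorem keepPort_succ_attachPorts (e : Fin n → C) (X : Matrix C C ℂ) (j : Fin n) :
    keepPort j.succ (attachPorts e X) = X.trace • Matrix.single (e j) (e j) 1 := by
  ext c c'
  simp only [keepPort, LinearMap.coe_mk, AddHom.coe_mk, Matrix.of_apply, attachPorts_apply_apply]
  rw [← (Fin.consEquiv fun _ => C).sum_comp]
  have h : ∀ (y : Fin n → C) (z : ℂ),
      (if y j = c then if y = e ∧ Function.update y j c' = e then z else 0 else 0) =
        if y = e then if e j = c ∧ e j = c' then z else 0 else 0 := by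
    intro y z
    by_cases hy : y = e
    · subst hy
      have : Function.update y j c' = y ↔ y j = c' := by
        rw [Function.update_eq_self_iff, eq_comm]
      simp [this, ite_and]
    · simp [hy]
  have h0 : ∀ x (y : Fin n → C),
      Function.update (Fin.cons x y : Fin (n + 1) → C) j.succ c' 0 = x := fun x y => by
    rw [Function.update_of_ne (Fin.succ_ne_zero j).symm, Fin.cons_zero]
  simp [Fin.consEquiv, Fintype.sum_prod_type, Matrix.single_apply, h, h0, Finset.sum_ite_irrel,
    Matrix.trace]

end Ports

/-- Partial trace over the second tensor factor. -/
def traceSnd {A B : Type*} [Fintype B] (X : Matrix (A × B) (A × B) ℂ) : Matrix A A ℂ :=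
  ∑ b, X.submatrix (fun a => (a, b)) (fun a => (a, b))

theorem posSemidef_traceSnd {A B : Type*} [Fintype B] {X : Matrix (A × B) (A × B) ℂ}
    (hX : X.PosSemidef) : (traceSnd X).PosSemidef :=
  Matrix.posSemidef_sum _ fun _ _ => hX.submatrix _

theorem trace_traceSnd {A B : Type*} [Fintype A] [Fintype B] (X : Matrix (A × B) (A × B) ℂ) :
    (traceSnd X).trace = X.trace := by
  simp only [traceSnd, Matrix.trace_sum]
  simp only [Matrix.trace, Fintype.sum_prod_type]
  exact Finset.sum_comm

theorem idTensor_keepPort_zero {A B C : Type*} [Fintype C] [DecidableEq C] {n : ℕ}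
    (E : SuperOp B C) (e : Fin n → C) (ρ : Matrix (A × B) (A × B) ℂ) :
    idTensor A (keepPort 0) (idTensor A (attachPorts e ∘ₗ E) ρ) = idTensor A E ρ := by
  ext p q
  simp only [idTensor, LinearMap.coe_mk, AddHom.coe_mk, Matrix.of_apply, LinearMap.comp_apply]
  exact congrFun (congrFun (keepPort_zero_attachPorts e (E _)) p.2) q.2

/-- A port with a fixed state is uncorrelated with Alice; tracing out port 0 leaves ρ_A because E
preserves the trace. -/
theorem idTensor_keepPort_succ {A B C : Type*} [Fintype B] [Fintype C] [DecidableEq C] {n : ℕ}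
    {E : SuperOp B C} (hE : IsTP E) (e : Fin n → C) (ρ : Matrix (A × B) (A × B) ℂ) (j : Fin n) :
    idTensor A (keepPort j.succ) (idTensor A (attachPorts e ∘ₗ E) ρ) =
      traceSnd ρ ⊗ₖ Matrix.single (e j) (e j) 1 := by
  rw [← idTensor_comp]
  ext p q
  simp only [idTensor, LinearMap.coe_mk, AddHom.coe_mk, Matrix.of_apply, LinearMap.comp_apply,
    keepPort_succ_attachPorts, hE _]
  simp [Matrix.trace, traceSnd, Matrix.sum_apply]

/-! ### Perturbing a perfect measurement -/

/-- A measurement `Q` that identifies each `T j` perfectly can be perturbed to gain from a further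
operator `σ`, as soon as `σ` exceeds `∑ j, T j` on some effect `P`. -/
theorem exists_povm_sum_trace_lt {H : Type*} [Fintype H] [DecidableEq H] {n : ℕ}
    {P σ : Matrix H H ℂ} {Q T : Fin n → Matrix H H ℂ} (hP : P.PosSemidef)
    (hP' : (1 - P).PosSemidef) (hσ : σ.PosSemidef) (hQ : ∀ j, (Q j).PosSemidef)
    (hQ1 : ∑ j, Q j = 1) (hT : ∀ j, (T j).PosSemidef) (hQT : ∀ j, Q j * T j = T j)
    (hTQ : ∀ j, T j * Q j = T j) (h : (P * ∑ j, T j).trace.re < (P * σ).trace.re) :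
    ∃ M : Fin (n + 1) → Matrix H H ℂ, IsPOVM M ∧
      ∑ j, (T j).trace.re < (M 0 * σ).trace.re + ∑ j, (M j.succ * T j).trace.re := by
  set x := (P * σ).trace.re with hx
  set y := (P * ∑ j, T j).trace.re with hy
  have hy0 : 0 ≤ y := trace_mul_re_nonneg hP (Matrix.posSemidef_sum _ fun j _ => hT j)
  have hx0 : 0 < x := hy0.trans_lt h
  obtain ⟨δ, hδ0, hδ2, hδ⟩ : ∃ δ : ℝ, 0 < δ ∧ δ ≤ 2 ∧ 2 * y < (2 - δ) * x := by
    -- With this δ, (2 - δ) x = x + y, which exceeds 2y.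
    refine ⟨(x - y) / x, div_pos (by linarith) hx0, ?_, ?_⟩
    · rw [div_le_iff₀ hx0]; linarith
    · rw [sub_mul, div_mul_cancel₀ _ hx0.ne']; linarith
  -- Sandwiching each Q_j by S frees the effect 1 - S², about 2δP, for the new outcome.
  set S : Matrix H H ℂ := 1 - δ • P with hS
  have hSH : S.conjTranspose = S := by
    simp [hS, Matrix.conjTranspose_sub, Matrix.conjTranspose_smul, hP.isHermitian.eq]
  -- P - P² = P(1 - P)P + (1 - P)P(1 - P).
  have hPP : (P - P * P).PosSemidef := by
    have h1 := hP'.mul_mul_conjTranspose_same P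
    have h2 := hP.mul_mul_conjTranspose_same (1 - P)
    rw [hP.isHermitian.eq] at h1
    rw [hP'.isHermitian.eq] at h2
    convert h1.add h2 using 1
    noncomm_ring
  have hSS : 1 - S * S = (δ * (2 - δ)) • P + δ ^ 2 • (P - P * P) := by
    rw [hS]
    simp only [sub_mul, mul_sub, one_mul, mul_one, smul_mul_assoc, mul_smul_comm]
    module
  refine ⟨Fin.cons (1 - S * S) fun j => S * Q j * S, ⟨fun i => ?_, ?_⟩, ?_⟩
  · induction i using Fin.cases with
    | zero =>
      rw [Fin.cons_zero, hSS]
      exact (hP.smul (mul_nonneg hδ0.le (by linarith))).add (hPP.smul (sq_nonneg δ))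
    | succ j =>
      rw [Fin.cons_succ]
      have := (hQ j).mul_mul_conjTranspose_same S
      rwa [hSH] at this
  · simp only [Fin.sum_univ_succ, Fin.cons_zero, Fin.cons_succ]
    rw [← Finset.sum_mul, ← Finset.mul_sum, hQ1]
    simp
  · simp only [Fin.cons_zero, Fin.cons_succ]
    have h0 : δ * (2 - δ) * x ≤ ((1 - S * S) * σ).trace.re := by
      have := mul_nonneg (sq_nonneg δ) (trace_mul_re_nonneg hPP hσ)
      rw [hSS, Matrix.add_mul, Matrix.trace_add, Matrix.smul_mul, Matrix.smul_mul,
        Matrix.trace_smul, Matrix.trace_smul, Complex.add_re, Complex.smul_re, Complex.smul_re,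
        smul_eq_mul, smul_eq_mul]
      linarith
    -- Since Q_j fixes T_j on both sides, both first-order terms have trace Tr(P T_j); the δ² term
    -- is nonnegative and is dropped.
    have hj : ∀ j, (T j).trace.re - 2 * δ * (P * T j).trace.re ≤ (S * Q j * S * T j).trace.re := by
      intro j
      have h1 := hQ j |>.mul_mul_conjTranspose_same P
      rw [hP.isHermitian.eq] at h1
      have h2 := mul_nonneg (sq_nonneg δ) (trace_mul_re_nonneg h1 (hT j))
      have h3 : (Q j * (P * T j)).trace = (P * T j).trace := by
        rw [Matrix.trace_mul_comm, Matrix.mul_assoc, hTQ]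
      have h4 : S * Q j * S * T j =
          T j - δ • (P * T j) - δ • (Q j * (P * T j)) + δ ^ 2 • (P * Q j * P * T j) := by
        rw [hS]
        simp only [sub_mul, mul_sub, one_mul, mul_one, smul_mul_assoc, mul_smul_comm,
          mul_assoc, hQT]
        module
      rw [h4]
      simp only [Matrix.trace_add, Matrix.trace_sub, Matrix.trace_smul, h3, Complex.add_re,
        Complex.sub_re, Complex.smul_re, smul_eq_mul]
      linarith
    have hsum := Finset.sum_le_sum fun j (_ : j ∈ Finset.univ) => hj j
    have hyy : y = ∑ j, (P * T j).trace.re := by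
      rw [hy, Matrix.mul_sum, Matrix.trace_sum, Complex.re_sum]
    rw [Finset.sum_sub_distrib, ← Finset.mul_sum, ← hyy] at hsum
    -- The gain δ(2 - δ)x beats the total loss 2δy.
    nlinarith [mul_lt_mul_of_pos_left hδ hδ0]

/-! ### The two implications -/

theorem PBTmax_subset_oneWayLOCC {A B C₀ C : Type*} [Fintype A] [DecidableEq A]
    [Fintype B] [Fintype C₀] [DecidableEq C₀] [Fintype C] [DecidableEq C] [Nonempty C]
    (ρ : Matrix (A × B) (A × B) ℂ) : PBTmax ρ C₀ C ⊆ oneWayLOCC ρ C₀ C := by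
  rintro Λ ⟨n, E, hE, P, ⟨hP, hP1⟩, hΛ⟩
  refine ⟨1, ∑ i, tensorMap (traceAgainst (P i)) (keepPort i ∘ₗ E),
    ⟨n, fun i => traceAgainst (P i), fun i => keepPort i ∘ₗ E, fun i => isCP_traceAgainst (hP i),
      fun X => ?_, fun i => (isChannel_keepPort i).comp hE, rfl⟩, fun τ => ?_⟩
  · rw [LinearMap.sum_apply, Matrix.trace_sum]
    simp only [trace_traceAgainst]
    rw [← Matrix.trace_sum, ← Matrix.sum_mul, hP1, Matrix.one_mul]
  · rw [hΛ, traceFst_sum_tensorMap fun i X => trace_traceAgainst (P i) X]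
    rfl

theorem exists_povm_of_mem_oneWayLOCC {A B C₀ C : Type*} [Fintype A] [DecidableEq A]
    [Fintype B] [Fintype C₀] [DecidableEq C₀] [Fintype C] [DecidableEq C]
    {ρ : Matrix (A × B) (A × B) ℂ} {Λ : SuperOp C₀ C} (hΛ : Λ ∈ oneWayLOCC ρ C₀ C) :
    ∃ (m : ℕ) (P : Fin m → Matrix (A × C₀) (A × C₀) ℂ) (E : Fin m → SuperOp B C),
      IsPOVM P ∧ (∀ i, IsChannel (E i)) ∧
      ∀ τ, Λ τ = ∑ i, traceFst
        ((P i ⊗ₖ (1 : Matrix C C ℂ)) * withInput (idTensor A (E i) ρ) τ) := by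
  obtain ⟨k, L, ⟨m, Φ, E, hΦ, hTP, hE, rfl⟩, hΛ⟩ := hΛ
  choose P hP hPt using fun i => (hΦ i).exists_posSemidef_trace_mul
  refine ⟨m, P, E, ⟨hP, ?_⟩, hE, fun τ => by rw [hΛ, traceFst_sum_tensorMap hPt]⟩
  -- Trace preservation of the instrument says that ∑ P_i and 1 have the same trace pairing with
  -- every X.
  refine Matrix.ext_iff_trace_mul_right.2 fun X => ?_
  have h := hTP X
  rw [LinearMap.sum_apply, Matrix.trace_sum] at h
  simp only [hPt] at h
  rw [Matrix.sum_mul, Matrix.trace_sum, h, Matrix.one_mul]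

theorem exists_mem_PBTmax {A B C : Type*} [Fintype A] [DecidableEq A] [Fintype B]
    [Fintype C] [DecidableEq C] [Nonempty C]
    {ρ : Matrix (A × B) (A × B) ℂ} (hρ : IsDensity ρ) {Λ : SuperOp C C}
    (hΛ : Λ ∈ oneWayLOCC ρ C C) (hF : 1 / (Fintype.card C : ℝ) < entFidelity Λ) :
    ∃ Λ' ∈ PBTmax ρ C C, 1 / (Fintype.card C : ℝ) < entFidelity Λ' := by
  obtain ⟨m, P, E, ⟨hP, hP1⟩, hE, hΛ⟩ := exists_povm_of_mem_oneWayLOCC hΛ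
  rw [one_div_card_lt_entFidelity_iff hΛ] at hF
  let e := (Fintype.equivFin C).symm
  let Q : Fin (Fintype.card C) → Matrix (A × C) (A × C) ℂ :=
    fun j => 1 ⊗ₖ Matrix.single (e j) (e j) 1
  let T : Fin (Fintype.card C) → Matrix (A × C) (A × C) ℂ :=
    fun j => traceSnd ρ ⊗ₖ Matrix.single (e j) (e j) 1
  have hs : ∀ c : C, (Matrix.single c c (1 : ℂ)).PosSemidef := by
    intro c
    rw [← Matrix.diagonal_single]
    refine Matrix.PosSemidef.diagonal (Pi.single_nonneg.2 zero_le_one)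
  have htr : ∀ j, (T j).trace = 1 := by
    intro j
    rw [Matrix.trace_kronecker, trace_traceSnd, hρ.2, Matrix.trace_single_eq_same, one_mul]
  have hT1 : ∑ j, (T j).trace.re = Fintype.card C := by simp [htr]
  have hone : ∑ j, Matrix.single (e j) (e j) (1 : ℂ) = 1 := by
    rw [e.sum_comp fun c => Matrix.single c c (1 : ℂ), Matrix.sum_single_one]
  -- Averaging: summed over i, the left sides give d and the right sides more than d.
  obtain ⟨i, hi⟩ : ∃ i, (P i * ∑ j, T j).trace.re < (P i * idTensor A (E i) ρ).trace.re := by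
    by_contra! hcon
    have h := Finset.sum_le_sum fun i (_ : i ∈ Finset.univ) => hcon i
    have h' : ∑ i, (P i * ∑ j, T j).trace.re = Fintype.card C := by
      rw [← Complex.re_sum, ← Matrix.trace_sum, ← Matrix.sum_mul, hP1, Matrix.one_mul,
        Matrix.trace_sum, Complex.re_sum, hT1]
    linarith
  have hPi : (1 - P i).PosSemidef := by
    rw [← hP1, ← Finset.sum_erase_eq_sub (Finset.mem_univ i)]
    exact Matrix.posSemidef_sum _ fun j _ => hP j
  obtain ⟨M, hM, hlt⟩ := exists_povm_sum_trace_lt (Q := Q) (T := T) (hP i) hPi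
    ((hE i).1.posSemidef_idTensor hρ.1) (fun j => Matrix.PosSemidef.one.kronecker (hs _))
    (by
      ext p q
      have := congrFun (congrFun hone p.2) q.2
      simp only [Matrix.sum_apply] at this
      simp only [Q, Matrix.sum_apply, Matrix.kroneckerMap_apply]
      rw [← Finset.mul_sum, this, ← Matrix.one_kronecker_one]
      rfl)
    (fun j => (posSemidef_traceSnd hρ.1).kronecker (hs _))
    (fun j => by simp [Q, T, ← Matrix.mul_kronecker_mul])
    (fun j => by simp [Q, T, ← Matrix.mul_kronecker_mul]) hi
  let σ := idTensor A (attachPorts e ∘ₗ E i) ρ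
  let Λ' : SuperOp C C :=
    { toFun := fun τ => ∑ i, traceFst
        ((M i ⊗ₖ (1 : Matrix C C ℂ)) * withInput (idTensor A (keepPort i) σ) τ)
      map_add' := fun τ τ' => by
        ext
        simp only [Matrix.add_apply, Matrix.sum_apply, traceFst_kronecker_mul_withInput, mul_add,
          Finset.sum_add_distrib]
      map_smul' := fun z τ => by
        ext
        simp only [Matrix.smul_apply, Matrix.sum_apply, traceFst_kronecker_mul_withInput,
          Finset.mul_sum, smul_eq_mul, RingHom.id_apply, mul_left_comm z] }
  refine ⟨Λ', ⟨_, attachPorts e ∘ₗ E i, (isChannel_attachPorts _).comp (hE i), M, hM,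
    fun τ => rfl⟩, ?_⟩
  rw [one_div_card_lt_entFidelity_iff (Λ := Λ') (P := M)
    (σ := fun i => idTensor A (keepPort i) σ) (fun τ => rfl), Fin.sum_univ_succ, ← hT1]
  simp only [σ, idTensor_keepPort_zero, idTensor_keepPort_succ (hE i).2]
  exact hlt

end QuantumPBT

theorem mainTheorem1 {A B C : Type*} [Fintype A] [DecidableEq A] [Fintype B]
    [Fintype C] [DecidableEq C] [Nonempty C]
    (ρ : Matrix (A × B) (A × B) ℂ) (hρ : QuantumPBT.IsDensity ρ) :
    (∃ Λ ∈ QuantumPBT.oneWayLOCC ρ C C,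
        1 / (Fintype.card C : ℝ) < QuantumPBT.entFidelity Λ) ↔
      (∃ Λ ∈ QuantumPBT.PBTmax ρ C C,
        1 / (Fintype.card C : ℝ) < QuantumPBT.entFidelity Λ) :=
  ⟨fun ⟨_, hΛ, hF⟩ => QuantumPBT.exists_mem_PBTmax hρ hΛ hF,
    fun ⟨Λ, hΛ, hF⟩ => ⟨Λ, QuantumPBT.PBTmax_subset_oneWayLOCC ρ hΛ, hF⟩⟩
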